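/- For positive integers $n,p$ let $\mathbf I_{n,p}(021)$ be the set of integer sequences $e=(e_1,\ldots,e_n)$ with $0\le e_1<p$ and $0\le e_i<p+i$ for $2\le i\le n$ (the $(p,p+2,p+3,\ldots,p+n)$-inversion sequences) that avoid the pattern $021$, that is, for which there are no indices $i<j<k$ with $e_i<e_k<e_j$. Let $\mathsf{lar}(e)=\max_i e_i$ and $\mathsf{asc}(e)=|\{1\le i\le n-1: e_i<e_{i+1}\}|$, and put $$\mathcal G(x,s,u)=\mathcal G(x,s,u,t)=\sum_{p\ge1}\sum_{n\ge1}x^ns^p\sum_{e\in\mathbf I_{n,p}(021)}u^{\mathsf{lar}(e)}t^{\mathsf{asc}(e)}.$$ Here $t$ is an indeterminate or, more generally, any element of a commutative ring $R$ of coefficients, and $\mathcal G$ is a formal power series in $x,s$ with coefficients in $R[u]$. **Theorem.** There is a unique formal power series $r\in R[[x]]$ without constant term (i.e. $r\to0$ as $x\to0$) such that $$r^3-(2+x+t-xt^2)r^2+(1+2x)r-x=0.$$ It begins $$r=x+tx^2+(t^2+2t)x^3+(t^3+8t^2+3t)x^4+(t^4+22t^3+27t^2+4t)x^5+\cdots.$$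 The series $(1-r)(1-xt)$ is invertible in $R[[x]]$, and the specialization of $\mathcal G$ at $s=xt$, $u=1$ is $$\mathcal G(x,xt,1)=\frac{t\big((1+x-xt)\,r-x\big)}{(1-r)(1-xt)}.$$ -/

import Mathlib

open scoped Classical

noncomputable section

namespace InvSeq

/-- The word `w` contains the pattern `P`: some subsequence of `w` is order isomorphic to `P`
(equal letters of `P` correspond to equal letters of the subsequence). -/
def Contains {n k : ℕ} (w : Fin n → ℕ) (P : Fin k → ℕ) : Prop :=
  ∃ f : Fin k ↪o Fin n, ∀ a b : Fin k, w (f a) < w (f b) ↔ P a < P b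

/-- The word `w` avoids the pattern `P`. -/
def Avoids {n k : ℕ} (w : Fin n → ℕ) (P : Fin k → ℕ) : Prop :=
  ¬ Contains w P

/-- The set of `s`-inversion sequences: `0 ≤ e i < s i` for all `i`. -/
def sInvSeq {n : ℕ} (s : Fin n → ℕ) : Finset (Fin n → ℕ) :=
  Fintype.piFinset fun i => Finset.range (s i)

/-- The sequence `(p, p + 2, p + 3, …, p + n)` of length `n`. Indices start at `0`, so the entry of
index `i ≥ 1` is `p + (i + 1)`. -/
def bound (n p : ℕ) : Fin n → ℕ :=
  fun i => if (i : ℕ) = 0 then p else p + (i + 1)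

/-- The set of `(p, p + 2, p + 3, …, p + n)`-inversion sequences that avoid the pattern `021`. -/
def inv021 (n p : ℕ) : Finset (Fin n → ℕ) :=
  (sInvSeq (bound n p)).filter fun e => Avoids e ![0, 2, 1]

/-- The number of ascents, i.e. of pairs of adjacent entries with the left one smaller. -/
def asc {n : ℕ} (w : Fin n → ℕ) : ℕ :=
  (Finset.univ.filter fun i : Fin n => ∃ h : (i : ℕ) + 1 < n, w i < w ⟨i + 1, h⟩).card

/-- The largest entry. -/
def lar {n : ℕ} (w : Fin n → ℕ) : ℕ :=
  Finset.univ.sup w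

variable {R : Type*} [CommRing R]

/-- The generating function `G(x, s, u, t)`, the sum over `n, p ≥ 1` and over the sequences `e` in
`inv021 n p` of `x ^ n * s ^ p * u ^ lar e * t ^ asc e`.
It is a power series in `x` (variable `0`) and `s` (variable `1`) whose coefficients are polynomials
in `u`. The mark `t` lies in the ground ring `R`; it is an indeterminate when `R` is a polynomial
or power series ring and `t` its variable. -/
def G (t : R) : MvPowerSeries (Fin 2) (Polynomial R) := fun m =>
  if 1 ≤ m 0 ∧ 1 ≤ m 1 then
    ∑ e ∈ inv021 (m 0) (m 1), (Polynomial.X : Polynomial R) ^ lar e * Polynomial.C (t ^ asc e)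
  else 0

/-- The series put in place of `x` and `s`, namely `x` and `x t`. -/
def point (t : R) : Fin 2 → PowerSeries R :=
  ![PowerSeries.X, PowerSeries.X * PowerSeries.C t]

/-- The substitution of `point t` is legitimate, as its members have no constant term. -/
theorem hasSubst_point (t : R) : MvPowerSeries.HasSubst (point t) := by
  apply MvPowerSeries.hasSubst_of_constantCoeff_zero
  intro i
  change PowerSeries.constantCoeff (point t i) = 0
  fin_cases i <;> simp [point]

/-- The specialization `G(x, x t, 1)`: first set `u = 1` in the coefficients, then substitute
`s = x t`. -/
def GSpec (t : R) : PowerSeries R :=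
  MvPowerSeries.subst (point t)
    (MvPowerSeries.map (Polynomial.evalRingHom (1 : R)) (G t))

/-- `r` is a power series root of `r³ - (2 + x + t - x t²) r² + (1 + 2 x) r - x = 0` with
`r → 0` as `x → 0`, i.e. without constant term. -/
def IsKernelRoot (t : R) (r : PowerSeries R) : Prop :=
  PowerSeries.constantCoeff r = 0 ∧
    r ^ 3 - (2 + PowerSeries.X + PowerSeries.C t - PowerSeries.X * PowerSeries.C t ^ 2) * r ^ 2
      + (1 + 2 * PowerSeries.X) * r - PowerSeries.X = 0

end InvSeq

end

namespace InvSeq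

/-! The proof is a kernel method on a generating tree that appends letters at the right. A sequence
is recorded by its ascents and by the number of its free letters, the positive letters that may come
next; `z` marks that number. Appending 0 keeps every free letter and adds one new largest one
(`card_free_snoc_zero`). If 0 already occurs, appending a free `v` keeps only the free letters `≥ v`
and adds the new one (`card_free_snoc`). A sequence without 0 is a shift by one of a sequence for `p
- 1`, with one more free letter (`card_free_add_one`).

With `s = xt`, let `P(z)` be the sum over all sequences and `C`, `A`, `B` the sums over those that
contain 0, end in 0, contain 0 without ending in it. The tree gives `C = (1 - txz) P`, an expression
of `A` through `P`, and a relation of `B` to `C(z) - C(1)`. As `C = A + B`, everything reduces to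
one linear equation in `P(z)` and `P(1)`. Its kernel, the factor of `P(z)`, becomes the given cubic
on writing `r = xz`. At the root `P(z)` drops out and `P(1)` is determined (`total_fullSum_one`).

The cancellations need a domain and `t ≠ 0`, so the identity is proved over `ℤ[t]` and carried to
any ring by base change and uniqueness of the root. -/

/-! ### Appending a letter and its effect on the free letters. -/

theorem avoids_021_iff {n : ℕ} (e : Fin n → ℕ) :
    Avoids e ![0, 2, 1] ↔ ∀ i j k, i < j → j < k → ¬ (e i < e k ∧ e k < e j) := by
  constructor
  · rintro h i j k hij hjk ⟨h1, h2⟩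
    refine h ⟨OrderEmbedding.ofStrictMono ![i, j, k] ?_, ?_⟩
    · intro a b hab
      fin_cases a <;> fin_cases b <;> simp at hab ⊢ <;> first | assumption | exact hij.trans hjk
    · intro a b
      change e (![i, j, k] a) < e (![i, j, k] b) ↔ _
      fin_cases a <;> fin_cases b <;> simp <;> omega
  · rintro h ⟨f, hf⟩
    refine h (f 0) (f 1) (f 2) (by simp) (by simp) ⟨?_, ?_⟩
    · exact (hf 0 2).2 (by simp)
    · exact (hf 2 1).2 (by simp)

/-- A letter `v` is compatible with `e` if appending it creates no pattern `021`. -/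
def Compatible {n : ℕ} (e : Fin n → ℕ) (v : ℕ) : Prop :=
  ∀ i j, i < j → ¬ (e i < v ∧ v < e j)

/-- The positive letters below `N` that are compatible with `e`. -/
noncomputable def free {n : ℕ} (N : ℕ) (e : Fin n → ℕ) : Finset ℕ :=
  (Finset.Ico 1 N).filter (Compatible e)

theorem mem_free {n N v : ℕ} {e : Fin n → ℕ} :
    v ∈ free N e ↔ (1 ≤ v ∧ v < N) ∧ Compatible e v := by
  simp [free]

theorem compatible_zero {n : ℕ} (e : Fin n → ℕ) : Compatible e 0 := by
  intro i j _ h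
  omega

theorem avoids_snoc_iff {n : ℕ} (e : Fin n → ℕ) (v : ℕ) :
    Avoids (Fin.snoc e v : Fin (n + 1) → ℕ) ![0, 2, 1] ↔ Avoids e ![0, 2, 1] ∧ Compatible e v := by
  simp only [avoids_021_iff, Compatible]
  constructor
  · intro h
    refine ⟨fun i j k hij hjk => ?_, fun i j hij => ?_⟩
    · simpa using h i.castSucc j.castSucc k.castSucc (by simpa) (by simpa)
    · simpa using h i.castSucc j.castSucc (Fin.last n) (by simpa) (Fin.castSucc_lt_last j)
  · rintro ⟨h, h'⟩ i j k hij hjk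
    induction j using Fin.lastCases with
    | last => exact absurd hjk (Fin.le_last k).not_gt
    | cast j =>
      induction i using Fin.lastCases with
      | last => exact absurd hij (Fin.castSucc_lt_last j).le.not_gt
      | cast i =>
        induction k using Fin.lastCases with
        | last => simpa using h' i j (by simpa using hij)
        | cast k => simpa using h i j k (by simpa using hij) (by simpa using hjk)

theorem mem_inv021 {n p : ℕ} {e : Fin n → ℕ} :
    e ∈ inv021 n p ↔ (∀ i, e i < bound n p i) ∧ Avoids e ![0, 2, 1] := by
  simp [inv021, sInvSeq]

theorem snoc_mem_inv021 {n p v : ℕ} {e : Fin (n + 1) → ℕ} :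
    (Fin.snoc e v : Fin (n + 2) → ℕ) ∈ inv021 (n + 2) p ↔
      e ∈ inv021 (n + 1) p ∧ v < p + n + 2 ∧ Compatible e v := by
  rw [mem_inv021, mem_inv021, avoids_snoc_iff, Fin.forall_fin_succ']
  simp [bound, add_assoc]
  tauto

theorem lt_of_mem_inv021 {n p : ℕ} {e : Fin (n + 1) → ℕ} (he : e ∈ inv021 (n + 1) p)
    (i : Fin (n + 1)) : e i < p + n + 2 := by
  have h := (mem_inv021.1 he).1 i
  have := i.2
  simp only [bound] at h
  split_ifs at h <;> omega

theorem sum_inv021_succ {M : Type*} [AddCommMonoid M] (n p : ℕ) (F : (Fin (n + 2) → ℕ) → M) :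
    ∑ e ∈ inv021 (n + 2) p, F e =
      ∑ e ∈ inv021 (n + 1) p,
        (F (Fin.snoc e 0) + ∑ v ∈ free (p + n + 2) e, F (Fin.snoc e v)) := by
  have h1 : ∀ e : Fin (n + 1) → ℕ,
      (Finset.range (p + n + 2)).filter (Compatible e) = insert 0 (free (p + n + 2) e) := by
    intro e
    ext v
    rcases Nat.eq_zero_or_pos v with rfl | hv
    · simp [compatible_zero]
    · simp [mem_free, hv.ne', Nat.succ_le_of_lt hv]
  have h2 : ∀ e : Fin (n + 1) → ℕ,
      F (Fin.snoc e 0) + ∑ v ∈ free (p + n + 2) e, F (Fin.snoc e v) =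
        ∑ v ∈ (Finset.range (p + n + 2)).filter (Compatible e), F (Fin.snoc e v) := by
    intro e
    rw [h1, Finset.sum_insert]
    simp [mem_free]
  simp only [h2]
  rw [Finset.sum_sigma']
  refine Finset.sum_bij' (fun e _ => ⟨Fin.init e, e (Fin.last _)⟩)
    (fun x _ => Fin.snoc x.1 x.2) ?_ ?_ ?_ ?_ ?_
  · intro e he
    rw [← Fin.snoc_init_self e, snoc_mem_inv021] at he
    simpa using he
  · rintro ⟨e, v⟩ he
    rw [snoc_mem_inv021]
    simpa using he
  · intro e _
    simp
  · rintro ⟨e, v⟩ _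
    simp
  · intro e _
    simp

theorem asc_succ {n : ℕ} (w : Fin (n + 1) → ℕ) :
    asc w = ∑ i : Fin n, if w i.castSucc < w i.succ then 1 else 0 := by
  rw [asc, Finset.card_filter, Fin.sum_univ_castSucc]
  simp [Fin.succ]

theorem asc_snoc {n : ℕ} (e : Fin (n + 1) → ℕ) (v : ℕ) :
    asc (Fin.snoc e v : Fin (n + 2) → ℕ) = asc e + if e (Fin.last n) < v then 1 else 0 := by
  rw [asc_succ, Fin.sum_univ_castSucc, asc_succ]
  congr 1
  · refine Finset.sum_congr rfl fun i _ => ?_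
    rw [← Fin.castSucc_succ]
    simp only [Fin.snoc_castSucc]
  · simp

theorem compatible_snoc {n : ℕ} {e : Fin n → ℕ} {v w : ℕ} :
    Compatible (Fin.snoc e v : Fin (n + 1) → ℕ) w ↔
      Compatible e w ∧ ∀ i, ¬ (e i < w ∧ w < v) := by
  constructor
  · intro h
    refine ⟨fun i j hij => ?_, fun i => ?_⟩
    · simpa using h i.castSucc j.castSucc (by simpa)
    · simpa using h i.castSucc (Fin.last n) (Fin.castSucc_lt_last i)
  · rintro ⟨h, h'⟩ i j hij
    induction i using Fin.lastCases with
    | last => exact absurd hij (Fin.le_last j).not_gt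
    | cast i =>
      induction j using Fin.lastCases with
      | last => simpa using h' i
      | cast j => simpa using h i j (by simpa using hij)

theorem compatible_of_forall_lt {n N : ℕ} {e : Fin n → ℕ} (h : ∀ i, e i < N) :
    Compatible e N := by
  intro i j _ hij
  exact absurd (h j) (by omega)

theorem card_free_snoc_zero {n N : ℕ} {e : Fin n → ℕ} (hN : 1 ≤ N) (h : ∀ i, e i < N) :
    (free (N + 1) (Fin.snoc e 0 : Fin (n + 1) → ℕ)).card = (free N e).card + 1 := by
  -- A final 0 cannot be the 2 of a pattern, so nothing is lost; `N` exceeds all entries and is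
  -- always compatible.
  have : free (N + 1) (Fin.snoc e 0 : Fin (n + 1) → ℕ) = insert N (free N e) := by
    ext v
    simp only [mem_free, compatible_snoc, Finset.mem_insert]
    have := compatible_of_forall_lt h
    constructor
    · rintro ⟨⟨h1, h2⟩, h3, -⟩
      rcases Nat.lt_succ_iff_lt_or_eq.1 h2 with h4 | h4
      · exact Or.inr ⟨⟨h1, h4⟩, h3⟩
      · exact Or.inl h4
    · rintro (rfl | ⟨⟨h1, h2⟩, h3⟩)
      · exact ⟨⟨hN, by omega⟩, this, fun i => by omega⟩
      · exact ⟨⟨h1, by omega⟩, h3, fun i => by omega⟩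
  rw [this, Finset.card_insert_of_notMem]
  simp [mem_free]

/-- An earlier 0 together with `v` forbids every positive letter below `v`. Larger letters see no
new obstruction. -/
theorem card_free_snoc {n N v : ℕ} {e : Fin n → ℕ} (h : ∀ i, e i < N) (h0 : ∃ i, e i = 0)
    (hv : v ∈ free N e) :
    (free (N + 1) (Fin.snoc e v : Fin (n + 1) → ℕ)).card =
      ((free N e).filter (v ≤ ·)).card + 1 := by
  obtain ⟨i0, hi0⟩ := h0
  have hv' := mem_free.1 hv
  have : free (N + 1) (Fin.snoc e v : Fin (n + 1) → ℕ) =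
      insert N ((free N e).filter (v ≤ ·)) := by
    ext w
    simp only [mem_free, compatible_snoc, Finset.mem_insert, Finset.mem_filter]
    have := compatible_of_forall_lt h
    constructor
    · rintro ⟨⟨h1, h2⟩, h3, h5⟩
      have := h5 i0
      rcases Nat.lt_succ_iff_lt_or_eq.1 h2 with h4 | h4
      · exact Or.inr ⟨⟨⟨h1, h4⟩, h3⟩, by omega⟩
      · exact Or.inl h4
    · rintro (rfl | ⟨⟨⟨h1, h2⟩, h3⟩, h4⟩)
      · exact ⟨⟨by omega, by omega⟩, this, fun i => by omega⟩
      · exact ⟨⟨h1, by omega⟩, h3, fun i => by omega⟩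
  rw [this, Finset.card_insert_of_notMem]
  simp [mem_free]

theorem last_mem_free {n N : ℕ} {e : Fin (n + 1) → ℕ} (h : ∀ i, e i < N)
    (ha : Avoids e ![0, 2, 1]) (hl : e (Fin.last n) ≠ 0) : e (Fin.last n) ∈ free N e := by
  rw [mem_free]
  refine ⟨⟨Nat.pos_of_ne_zero hl, h _⟩, fun i j hij hc => ?_⟩
  have hj : j < Fin.last n := by
    refine lt_of_le_of_ne (Fin.le_last j) ?_
    rintro rfl
    omega
  exact (avoids_021_iff e).1 ha i j _ hij hj hc

theorem last_le_of_mem_free {n N v : ℕ} {e : Fin (n + 1) → ℕ} (h0 : ∃ i, e i = 0)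
    (hv : v ∈ free N e) : e (Fin.last n) ≤ v := by
  obtain ⟨i0, hi0⟩ := h0
  obtain ⟨⟨h1, -⟩, h2⟩ := mem_free.1 hv
  by_contra hlt
  have hi : i0 < Fin.last n := by
    refine lt_of_le_of_ne (Fin.le_last _) ?_
    rintro rfl
    omega
  exact h2 i0 _ hi ⟨by omega, by omega⟩

/-- As `v` runs through `s`, the number of elements `≥ v` takes each value from 1 to `s.card` once.
-/
theorem sum_card_filter_le {M : Type*} [AddCommMonoid M] (s : Finset ℕ) (g : ℕ → M) :
    ∑ v ∈ s, g (s.filter (v ≤ ·)).card = ∑ i ∈ Finset.range s.card, g (i + 1) := by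
  induction s using Finset.induction_on_min with
  | empty => simp
  | insert a s ha ih =>
    have hn : a ∉ s := fun h => lt_irrefl _ (ha a h)
    rw [Finset.sum_insert hn, Finset.card_insert_of_notMem hn, Finset.sum_range_succ, ← ih,
      add_comm]
    congr 1
    · refine Finset.sum_congr rfl fun v hv => ?_
      rw [Finset.filter_insert, if_neg (ha v hv).not_ge]
    · rw [Finset.filter_true_of_mem, Finset.card_insert_of_notMem hn]
      intro v hv
      rcases Finset.mem_insert.1 hv with rfl | hv
      · exact le_rfl
      · exact (ha v hv).le

/-! ### Sequences without zero as shifts. -/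

theorem compatible_add_one {n v : ℕ} {e : Fin n → ℕ} :
    Compatible (fun i => e i + 1) (v + 1) ↔ Compatible e v := by
  simp [Compatible]

theorem card_free_add_one {n N : ℕ} (hN : 1 ≤ N) (e : Fin n → ℕ) :
    (free (N + 1) (fun i => e i + 1)).card = (free N e).card + 1 := by
  -- The shift of the letter 0, always compatible but not counted as free, is the letter 1, which is
  -- counted.
  have : free (N + 1) (fun i => e i + 1) = insert 1 ((free N e).image (· + 1)) := by
    ext v
    rcases v with - | v
    · simp [mem_free]
    · rcases v with - | v
      · simp [mem_free, Compatible]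
        omega
      · simp [mem_free, compatible_add_one]
  rw [this, Finset.card_insert_of_notMem, Finset.card_image_of_injective]
  · exact add_left_injective 1
  · simp [mem_free]

theorem add_one_mem_inv021 {n p : ℕ} {e : Fin n → ℕ} :
    (fun i => e i + 1) ∈ inv021 n (p + 1) ↔ e ∈ inv021 n p := by
  simp only [mem_inv021, avoids_021_iff, bound]
  refine and_congr (forall_congr' fun i => ?_) (by simp)
  split_ifs <;> omega

theorem asc_add_one {n : ℕ} (e : Fin n → ℕ) : asc (fun i => e i + 1) = asc e := by
  simp [asc]

theorem sum_inv021_no_zero {M : Type*} [AddCommMonoid M] (n p : ℕ) (F : (Fin n → ℕ) → M) :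
    ∑ e ∈ (inv021 n (p + 1)).filter (fun e => ¬ ∃ i, e i = 0), F e =
      ∑ e ∈ inv021 n p, F (fun i => e i + 1) := by
  symm
  refine Finset.sum_bij' (fun e _ i => e i + 1) (fun e _ i => e i - 1) ?_ ?_ ?_ ?_ ?_
  · intro e he
    simp [add_one_mem_inv021, he]
  · intro e he
    rw [Finset.mem_filter] at he
    rw [← add_one_mem_inv021]
    convert he.1 using 2 with i
    have : e i ≠ 0 := fun h => he.2 ⟨i, h⟩
    omega
  · intro e _
    simp
  · intro e he
    rw [Finset.mem_filter] at he
    funext i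
    have : e i ≠ 0 := fun h => he.2 ⟨i, h⟩
    simp only
    omega
  · intro e _
    rfl

theorem inv021_zero_right (n : ℕ) : inv021 (n + 1) 0 = ∅ := by
  ext e
  simp only [mem_inv021, Finset.notMem_empty, iff_false, not_and]
  intro h
  simpa [bound] using h 0

/-! ### Recurrences in the length and in `p`, with catalytic variable `z`. -/

section Weighted

variable {B : Type*} [CommRing B] (t z : B)

/-- The monomial that records the ascents and the number of free letters. -/
noncomputable def weight {n : ℕ} (p : ℕ) (e : Fin (n + 1) → ℕ) : B :=
  t ^ asc e * z ^ (free (p + n + 2) e).card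

/-- The total weight of all sequences. -/
noncomputable def fullSum (n p : ℕ) : B :=
  ∑ e ∈ inv021 (n + 1) p, weight t z p e

/-- The total weight of the sequences that contain the letter zero. -/
noncomputable def zeroSum (n p : ℕ) : B :=
  ∑ e ∈ (inv021 (n + 1) p).filter (fun e => ∃ i, e i = 0), weight t z p e

/-- The total weight of the sequences that end in zero. -/
noncomputable def endZeroSum (n p : ℕ) : B :=
  ∑ e ∈ (inv021 (n + 1) p).filter (fun e => e (Fin.last n) = 0), weight t z p e

/-- The total weight of the sequences that contain zero but do not end in it. -/
noncomputable def endPosSum (n p : ℕ) : B :=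
  ∑ e ∈ ((inv021 (n + 1) p).filter (fun e => ∃ i, e i = 0)).filter
    (fun e => ¬ e (Fin.last n) = 0), weight t z p e

theorem zeroSum_eq (n p : ℕ) : zeroSum t z n p = endZeroSum t z n p + endPosSum t z n p := by
  rw [zeroSum, endPosSum, endZeroSum, ← Finset.sum_filter_add_sum_filter_not _
    (fun e : Fin (n + 1) → ℕ => e (Fin.last n) = 0), Finset.filter_filter]
  congr 2
  ext e
  simp only [Finset.mem_filter, and_congr_right_iff, and_iff_right_iff_imp]
  exact fun _ h => ⟨_, h⟩

theorem fullSum_zero (n : ℕ) : fullSum t z n 0 = 0 := by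
  simp [fullSum, inv021_zero_right]

theorem zeroSum_zero (n : ℕ) : zeroSum t z n 0 = 0 := by
  simp [zeroSum, inv021_zero_right]

theorem fullSum_succ (n p : ℕ) :
    fullSum t z n (p + 1) = zeroSum t z n (p + 1) + z * fullSum t z n p := by
  rw [fullSum, ← Finset.sum_filter_add_sum_filter_not _ (fun e : Fin (n + 1) → ℕ => ∃ i, e i = 0),
    sum_inv021_no_zero, ← zeroSum, fullSum, Finset.mul_sum]
  congr 1
  refine Finset.sum_congr rfl fun e _ => ?_
  rw [weight, weight, asc_add_one, show p + 1 + n + 2 = (p + n + 2) + 1 by ring,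
    card_free_add_one (by omega)]
  ring

theorem endZeroSum_succ (n p : ℕ) : endZeroSum t z (n + 1) p = z * fullSum t z n p := by
  rw [endZeroSum, Finset.sum_filter, sum_inv021_succ, fullSum, Finset.mul_sum]
  refine Finset.sum_congr rfl fun e he => ?_
  rw [Finset.sum_eq_zero, add_zero]
  · rw [if_pos (by simp), weight, weight, asc_snoc, show p + (n + 1) + 2 = (p + n + 2) + 1 by ring,
      card_free_snoc_zero (by omega) (lt_of_mem_inv021 he)]
    simp
    ring
  · intro v hv
    have := (mem_free.1 hv).1.1
    rw [if_neg]
    simp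
    omega

/-- Since 0 occurs, every free letter is at least the last entry, so appending it makes an ascent
unless the two are equal. The children's free counts form an interval, and the factor `z - 1` sums
the geometric series. A nonzero last entry is itself the least free letter; the term with `1 - t`
corrects its missing ascent. -/
theorem mul_sum_free {n p : ℕ} {e : Fin (n + 1) → ℕ} (he : e ∈ inv021 (n + 1) p)
    (h0 : ∃ i, e i = 0) :
    (z - 1) * ∑ v ∈ free (p + n + 2) e, weight t z p (Fin.snoc e v : Fin (n + 2) → ℕ) =
      t * z ^ 2 * (weight t z p e - weight t 1 p e) +
        (1 - t) * (z - 1) * z * if e (Fin.last n) = 0 then 0 else weight t z p e := by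
  set s := free (p + n + 2) e with hs
  have key : ∀ v ∈ s, weight t z p (Fin.snoc e v : Fin (n + 2) → ℕ) =
      t ^ asc e * t * z ^ ((s.filter (v ≤ ·)).card + 1) +
        if v = e (Fin.last n) then t ^ asc e * (1 - t) * z ^ (s.card + 1) else 0 := by
    intro v hv
    rw [weight, asc_snoc, show p + (n + 1) + 2 = (p + n + 2) + 1 by ring,
      card_free_snoc (lt_of_mem_inv021 he) h0 hv, ← hs]
    have hle := last_le_of_mem_free h0 hv
    by_cases hve : v = e (Fin.last n)
    · have : s.filter (v ≤ ·) = s :=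
        Finset.filter_true_of_mem fun w hw => hve ▸ last_le_of_mem_free h0 hw
      rw [this, if_neg (by omega), if_pos hve]
      ring
    · rw [if_pos (by omega), if_neg hve]
      ring
  rw [Finset.sum_congr rfl key, Finset.sum_add_distrib, ← Finset.mul_sum,
    sum_card_filter_le s (fun i => z ^ (i + 1)), Finset.sum_ite_eq']
  have hgeom := mul_geom_sum z s.card
  have hsum : ∑ i ∈ Finset.range s.card, z ^ (i + 1 + 1) =
      z ^ 2 * ∑ i ∈ Finset.range s.card, z ^ i := by
    rw [Finset.mul_sum]
    exact Finset.sum_congr rfl fun i _ => by ring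
  have hmem : e (Fin.last n) ∈ s ↔ ¬ e (Fin.last n) = 0 := by
    refine ⟨fun h => ?_, last_mem_free (lt_of_mem_inv021 he) (mem_inv021.1 he).2⟩
    have := (mem_free.1 h).1.1
    omega
  rw [hsum, weight, weight, ← hs]
  by_cases hl : e (Fin.last n) = 0
  · rw [if_neg (by rw [hmem]; simpa using hl), if_pos hl]
    linear_combination t ^ asc e * t * z ^ 2 * hgeom
  · rw [if_pos (hmem.2 hl), if_neg hl]
    linear_combination t ^ asc e * t * z ^ 2 * hgeom

theorem endPosSum_succ (n p : ℕ) :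
    (z - 1) * endPosSum t z (n + 1) p =
      t * z ^ 2 * (zeroSum t z n p - zeroSum t 1 n p) +
        (1 - t) * (z - 1) * z * endPosSum t z n p := by
  rw [endPosSum, Finset.filter_filter, Finset.sum_filter, sum_inv021_succ]
  have h1 : ∀ e ∈ inv021 (n + 1) p,
      ((if (∃ i, (Fin.snoc e 0 : Fin (n + 2) → ℕ) i = 0) ∧
          ¬ (Fin.snoc e 0 : Fin (n + 2) → ℕ) (Fin.last (n + 1)) = 0
        then weight t z p (Fin.snoc e 0 : Fin (n + 2) → ℕ) else 0) +
        ∑ v ∈ free (p + n + 2) e,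
          if (∃ i, (Fin.snoc e v : Fin (n + 2) → ℕ) i = 0) ∧
            ¬ (Fin.snoc e v : Fin (n + 2) → ℕ) (Fin.last (n + 1)) = 0
          then weight t z p (Fin.snoc e v : Fin (n + 2) → ℕ) else 0) =
      if ∃ i, e i = 0 then
        ∑ v ∈ free (p + n + 2) e, weight t z p (Fin.snoc e v : Fin (n + 2) → ℕ) else 0 := by
    intro e _
    rw [if_neg (by simp), zero_add]
    have h2 : ∀ v ∈ free (p + n + 2) e,
        ((∃ i, (Fin.snoc e v : Fin (n + 2) → ℕ) i = 0) ∧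
          ¬ (Fin.snoc e v : Fin (n + 2) → ℕ) (Fin.last (n + 1)) = 0) ↔ ∃ i, e i = 0 := by
      intro v hv
      have := (mem_free.1 hv).1.1
      rw [Fin.exists_fin_succ']
      simp only [Fin.snoc_castSucc, Fin.snoc_last]
      constructor
      · rintro ⟨h | h, h'⟩
        · exact h
        · exact absurd h h'
      · exact fun h => ⟨Or.inl h, by omega⟩
    split_ifs with h
    · exact Finset.sum_congr rfl fun v hv => if_pos ((h2 v hv).2 h)
    · exact Finset.sum_eq_zero fun v hv => if_neg fun h' => h ((h2 v hv).1 h')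
  rw [Finset.sum_congr rfl h1, ← Finset.sum_filter, zeroSum, zeroSum, endPosSum,
    Finset.sum_filter (fun e : Fin (n + 1) → ℕ => ¬ e (Fin.last n) = 0), ← Finset.sum_sub_distrib,
    Finset.mul_sum, Finset.mul_sum, Finset.mul_sum, ← Finset.sum_add_distrib]
  refine Finset.sum_congr rfl fun e he => ?_
  rw [Finset.mem_filter] at he
  rw [mul_sum_free t z he.1 he.2]
  simp only [ite_not]

theorem endZeroSum_zero_left (p : ℕ) :
    endZeroSum t z 0 (p + 1) = z ^ (p + 2) := by
  have h : (inv021 1 (p + 1)).filter (fun e : Fin 1 → ℕ => e (Fin.last 0) = 0) = {fun _ => 0} := by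
    ext e
    simp only [Finset.mem_filter, Finset.mem_singleton, mem_inv021, avoids_021_iff]
    constructor
    · rintro ⟨-, h⟩
      funext i
      rwa [Subsingleton.elim i (Fin.last 0)]
    · rintro rfl
      simp [bound]
  have hf : free (p + 1 + 0 + 2) (fun _ : Fin 1 => 0) = Finset.Ico 1 (p + 3) := by
    ext v
    simp [mem_free, Compatible]
  rw [endZeroSum, h, Finset.sum_singleton, weight, hf]
  simp [asc]

theorem endZeroSum_zero_right (n : ℕ) : endZeroSum t z n 0 = 0 := by
  simp [endZeroSum, inv021_zero_right]

theorem endPosSum_zero_left (p : ℕ) : endPosSum t z 0 p = 0 := by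
  rw [endPosSum, Finset.filter_filter, Finset.filter_false_of_mem, Finset.sum_empty]
  rintro e - ⟨⟨i, hi⟩, h⟩
  rw [Fin.eq_zero i] at hi
  exact h hi

end Weighted

open PowerSeries

/-! ### Summation over length and `p` as power series in `X`. -/

section Totals

variable {A : Type*} [CommRing A]

/-- The sum `∑ i, X ^ i * f i`. -/
noncomputable def diag (f : ℕ → A⟦X⟧) : A⟦X⟧ :=
  PowerSeries.mk fun k => ∑ ij ∈ Finset.HasAntidiagonal.antidiagonal k, coeff ij.2 (f ij.1)

theorem coeff_diag (f : ℕ → A⟦X⟧) (k : ℕ) :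
    coeff k (diag f) = ∑ ij ∈ Finset.HasAntidiagonal.antidiagonal k, coeff ij.2 (f ij.1) :=
  coeff_mk _ _

theorem diag_add (f g : ℕ → A⟦X⟧) : diag (fun i => f i + g i) = diag f + diag g := by
  ext k
  simp [coeff_diag, Finset.sum_add_distrib]

theorem diag_mul (b : A⟦X⟧) (f : ℕ → A⟦X⟧) : diag (fun i => b * f i) = b * diag f := by
  ext k
  simp only [coeff_diag, coeff_mul, Finset.mul_sum]
  rw [Finset.sum_sigma', Finset.sum_sigma']
  -- Both sides run over triples with sum `k`; the map exchanges the exponent of `X` with the degree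
  -- taken from `b`, and is its own inverse.
  refine Finset.sum_bij' (fun x _ => ⟨(x.2.1, x.1.1 + x.2.2), (x.1.1, x.2.2)⟩)
    (fun x _ => ⟨(x.2.1, x.1.1 + x.2.2), (x.1.1, x.2.2)⟩) ?_ ?_ ?_ ?_ ?_
  all_goals rintro ⟨⟨a, b⟩, ⟨c, d⟩⟩ h
  all_goals simp only [Finset.mem_sigma, Finset.HasAntidiagonal.mem_antidiagonal] at h ⊢
  · exact ⟨by omega, trivial⟩
  · exact ⟨by omega, trivial⟩
  · obtain ⟨h1, h2⟩ := h
    subst h2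
    rfl
  · obtain ⟨h1, h2⟩ := h
    subst h2
    rfl

theorem diag_zero : diag (fun _ => (0 : A⟦X⟧)) = 0 := by
  ext k
  simp [coeff_diag]

theorem diag_succ (f : ℕ → A⟦X⟧) : diag f = f 0 + X * diag (fun i => f (i + 1)) := by
  ext k
  rcases k with - | k
  · simp [coeff_diag]
  · rw [map_add, coeff_succ_X_mul, coeff_diag, coeff_diag, Finset.Nat.sum_antidiagonal_succ]

/-- The sum `∑ n p, X ^ (n + p) * c ^ p * g n p`. -/
noncomputable def total (c : A⟦X⟧) (g : ℕ → ℕ → A⟦X⟧) : A⟦X⟧ :=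
  diag fun k => ∑ np ∈ Finset.HasAntidiagonal.antidiagonal k, c ^ np.2 * g np.1 np.2

variable (c : A⟦X⟧)

theorem total_add (g h : ℕ → ℕ → A⟦X⟧) :
    total c (fun n p => g n p + h n p) = total c g + total c h := by
  simp only [total, mul_add, Finset.sum_add_distrib, diag_add]

theorem total_mul (b : A⟦X⟧) (g : ℕ → ℕ → A⟦X⟧) :
    total c (fun n p => b * g n p) = b * total c g := by
  simp only [total, ← diag_mul, Finset.mul_sum]
  simp only [mul_left_comm b]

theorem total_succ_left (g : ℕ → ℕ → A⟦X⟧) :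
    total c g = diag (fun p => c ^ p * g 0 p) + X * total c (fun n p => g (n + 1) p) := by
  simp only [total]
  rw [diag_succ, diag_succ fun p => c ^ p * g 0 p]
  simp only [Finset.Nat.sum_antidiagonal_succ, diag_add]
  simp
  ring

theorem total_succ_right (g : ℕ → ℕ → A⟦X⟧) (hg : ∀ n, g n 0 = 0) :
    total c g = c * X * total c (fun n p => g n (p + 1)) := by
  rw [mul_comm c, mul_assoc, ← total_mul]
  simp only [total]
  rw [diag_succ]
  simp only [Finset.Nat.sum_antidiagonal_succ', hg]
  simp [pow_succ, mul_assoc, hg]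

theorem diag_geom (z : A⟦X⟧) :
    (1 - c * X * z) * diag (fun p => c ^ (p + 1) * z ^ (p + 2)) = c * z ^ 2 := by
  have h : diag (fun p => c ^ (p + 1) * z ^ (p + 2)) =
      c * z ^ 2 + X * ((c * z) * diag (fun p => c ^ (p + 1) * z ^ (p + 2))) := by
    conv_lhs => rw [diag_succ]
    have : ∀ i, c ^ (i + 1 + 1) * z ^ (i + 1 + 2) = c * z * (c ^ (i + 1) * z ^ (i + 2)) :=
      fun i => by ring
    simp only [this, zero_add, pow_one, diag_mul]
  linear_combination h

end Totals

/-! ### The functional equation and its kernel. -/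

section Kernel

variable {A : Type*} [CommRing A] (t : A⟦X⟧) (z : A⟦X⟧)

theorem total_zeroSum :
    total t (zeroSum t z) = (1 - t * X * z) * total t (fullSum t z) := by
  have h : total t (fullSum t z) =
      total t (zeroSum t z) + t * X * z * total t (fullSum t z) := by
    conv_lhs => rw [total_succ_right t (fullSum t z) (fullSum_zero t z)]
    rw [total_succ_right t (zeroSum t z) (zeroSum_zero t z)]
    simp only [fullSum_succ]
    rw [total_add, total_mul]
    ring
  linear_combination -h

theorem total_endZeroSum :
    (1 - t * X * z) * total t (endZeroSum t z) =
      X * t * z ^ 2 + (1 - t * X * z) * (X * z * total t (fullSum t z)) := by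
  have h := diag_geom t z
  rw [total_succ_left]
  simp only [endZeroSum_succ, total_mul]
  rw [diag_succ]
  simp only [endZeroSum_zero_left, endZeroSum_zero_right]
  linear_combination X * h

theorem total_endPosSum :
    (z - 1) * total t (endPosSum t z) =
      X * (t * z ^ 2 * (total t (zeroSum t z) - total t (zeroSum t 1)) +
        (1 - t) * (z - 1) * z * total t (endPosSum t z)) := by
  have h0 : diag (fun p => t ^ p * endPosSum t z 0 p) = 0 := by
    simp only [endPosSum_zero_left, mul_zero, diag_zero]
  have h1 : (z - 1) * total t (fun n p => endPosSum t z (n + 1) p) =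
      t * z ^ 2 * (total t (zeroSum t z) - total t (zeroSum t 1)) +
        (1 - t) * (z - 1) * z * total t (endPosSum t z) := by
    rw [← total_mul]
    simp only [endPosSum_succ, sub_eq_add_neg (zeroSum t z _ _), mul_add (t * z ^ 2), mul_neg,
      ← neg_mul (t * z ^ 2)]
    rw [total_add, total_add, total_mul, total_mul, total_mul]
    change _ * total t (zeroSum t z) + _ * total t (zeroSum t 1) +
      _ * total t (endPosSum t z) = _
    ring
  have h2 := total_succ_left t (endPosSum t z)
  rw [h0, zero_add] at h2
  linear_combination X * h1 + (z - 1) * h2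

/-- The functional equation at a root of the kernel. -/
theorem total_fullSum_one [IsDomain A] (ht : t ≠ 0) (hz : constantCoeff z = 1)
    (hk : (z * X - X) * (1 - z * X + t * (z * X)) * (1 - t * (z * X) - z * X) =
      t * (z * X) ^ 2 * (1 - t * (z * X))) :
    (1 - X * t) * total t (fullSum t 1) * (1 - z * X - t * (z * X)) = X * t * z ^ 2 := by
  have hC := total_zeroSum t z
  have hC1 := total_zeroSum t 1
  have hA := total_endZeroSum t z
  have hB := total_endPosSum t z
  have hAB : total t (zeroSum t z) = total t (endZeroSum t z) + total t (endPosSum t z) := by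
    rw [← total_add]
    simp only [← zeroSum_eq]
  have hX : (X : A⟦X⟧) ≠ 0 := X_ne_zero
  have hz0 : z ≠ 0 := by
    rintro rfl
    simp at hz
  have hu : 1 - t * X * z ≠ 0 := by
    intro h
    have := congrArg constantCoeff h
    simp at this
  have hk' : (z - 1) * (1 - z * X + t * (z * X)) * (1 - t * (z * X) - z * X) =
      X * t * z ^ 2 * (1 - t * (z * X)) :=
    mul_left_cancel₀ hX (by linear_combination hk)
  -- The factor `X t z²` is the coefficient of `C(z) - C(1)`, and `1 - tXz` clears the denominator
  -- of `A`.
  refine mul_left_cancel₀ (mul_ne_zero (mul_ne_zero (mul_ne_zero hX ht) (pow_ne_zero 2 hz0)) hu) ?_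
  generalize total t (fullSum t z) = P at *
  generalize total t (fullSum t 1) = P1 at *
  generalize total t (zeroSum t z) = C0 at *
  generalize total t (zeroSum t 1) = C1 at *
  generalize total t (endZeroSum t z) = A0 at *
  generalize total t (endPosSum t z) = B0 at *
  subst hC hC1
  have hB0 : B0 = (1 - t * X * z) * P - A0 := by linear_combination -hAB
  subst hB0
  -- The kernel relation enters twice: to remove `P`, and to rewrite the remaining `(z - 1)(1 - zX +
  -- tzX)`.
  linear_combination (1 - t * X * z - z * X) * ((1 - t * X * z) * hB +
    (z - 1) * (1 - z * X + t * (z * X)) * hA - (1 - t * X * z) * P * hk') + X * t * z ^ 2 * hk'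

end Kernel

/-! ### The power series root of the cubic. -/

section Root

variable {R : Type*} [CommRing R] (t : R)

/-- The map whose fixed points are the roots of the cubic. -/
noncomputable def rootStep (r : R⟦X⟧) : R⟦X⟧ :=
  X + (2 + X + C t - X * C t ^ 2) * r ^ 2 - r ^ 3 - 2 * X * r

theorem isKernelRoot_iff {r : R⟦X⟧} :
    IsKernelRoot t r ↔ constantCoeff r = 0 ∧ rootStep t r = r := by
  rw [IsKernelRoot, rootStep]
  refine and_congr_right fun _ => ⟨fun h => ?_, fun h => ?_⟩
  · linear_combination -h
  · linear_combination -h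

/-- The terms involving `r` are at least quadratic or carry a factor `X`, so the map is an `X`-adic
contraction on series without constant term. Existence and uniqueness of the root follow. -/
theorem X_pow_succ_dvd_rootStep_sub {n : ℕ} {a b : R⟦X⟧} (ha : X ∣ a) (hb : X ∣ b)
    (h : X ^ n ∣ a - b) : X ^ (n + 1) ∣ rootStep t a - rootStep t b := by
  obtain ⟨d, hd⟩ := h
  obtain ⟨a, rfl⟩ := ha
  obtain ⟨b, rfl⟩ := hb
  refine ⟨d * ((2 + X + C t - X * C t ^ 2) * (a + b) -
    X * (a ^ 2 + a * b + b ^ 2) - 2), ?_⟩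
  rw [rootStep, rootStep]
  linear_combination X * ((2 + X + C t - X * C t ^ 2) * (a + b) -
    X * (a ^ 2 + a * b + b ^ 2) - 2) * hd

theorem X_dvd_rootStep {a : R⟦X⟧} (ha : X ∣ a) : X ∣ rootStep t a := by
  obtain ⟨a, rfl⟩ := ha
  refine ⟨1 + (2 + X + C t - X * C t ^ 2) * (X * a ^ 2) - X ^ 2 * a ^ 3 - 2 * X * a, ?_⟩
  rw [rootStep]
  ring

theorem eq_zero_of_forall_X_pow_dvd {a : R⟦X⟧} (h : ∀ n, X ^ n ∣ a) : a = 0 := by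
  ext n
  exact X_pow_dvd_iff.1 (h (n + 1)) n (Nat.lt_succ_self n)

theorem exists_isKernelRoot : ∃ r, IsKernelRoot t r := by
  let u : ℕ → R⟦X⟧ := fun n => (rootStep t)^[n] 0
  have hu : ∀ n, u (n + 1) = rootStep t (u n) := fun n => Function.iterate_succ_apply' _ _ _
  have hX : ∀ n, X ∣ u n := by
    intro n
    induction n with
    | zero => exact dvd_zero _
    | succ n ih => exact hu n ▸ X_dvd_rootStep t ih
  have hstep : ∀ n, X ^ n ∣ u (n + 1) - u n := by
    intro n
    induction n with
    | zero => simp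
    | succ n ih =>
      rw [hu (n + 1), hu n]
      exact X_pow_succ_dvd_rootStep_sub t (hu n ▸ hX (n + 1)) (hX n) (by rwa [← hu n])
  have hle : ∀ m k, X ^ m ∣ u (m + k) - u m := by
    intro m k
    induction k with
    | zero => simp
    | succ k ih =>
      have := dvd_add ((pow_dvd_pow X (Nat.le_add_right m k)).trans (hstep (m + k))) ih
      simpa [add_assoc] using this
  -- The limit of the iterates: the coefficient of `X ^ k` is stable from `u (k + 1)` on.
  let r : R⟦X⟧ := PowerSeries.mk fun k => coeff k (u (k + 1))
  have hr : ∀ n, X ^ n ∣ r - u n := by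
    intro n
    rw [X_pow_dvd_iff]
    intro m hm
    obtain ⟨k, rfl⟩ := Nat.exists_eq_add_of_lt hm
    have := X_pow_dvd_iff.1 (hle (m + 1) k) m (Nat.lt_succ_self m)
    rw [map_sub, sub_eq_zero] at this ⊢
    rw [coeff_mk, show m + k + 1 = m + 1 + k by ring, this]
  have hXr : X ∣ r := by
    have := dvd_add (by simpa using hr 1) (hX 1)
    simpa using this
  refine ⟨r, (isKernelRoot_iff t).2 ⟨X_dvd_iff.1 hXr, ?_⟩⟩
  rw [← sub_eq_zero]
  refine eq_zero_of_forall_X_pow_dvd fun n => ?_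
  have h1 := (pow_dvd_pow X n.le_succ).trans (X_pow_succ_dvd_rootStep_sub t hXr (hX n) (hr n))
  have h2 := (pow_dvd_pow X n.le_succ).trans (hr (n + 1))
  rw [hu] at h2
  simpa using dvd_sub h1 h2

theorem IsKernelRoot.unique {r r' : R⟦X⟧} (h : IsKernelRoot t r) (h' : IsKernelRoot t r') :
    r = r' := by
  rw [isKernelRoot_iff] at h h'
  rw [← sub_eq_zero]
  refine eq_zero_of_forall_X_pow_dvd fun n => ?_
  induction n with
  | zero => simp
  | succ n ih =>
    have := X_pow_succ_dvd_rootStep_sub t (X_dvd_iff.2 h.1) (X_dvd_iff.2 h'.1) ih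
    rwa [h.2, h'.2] at this

theorem IsKernelRoot.coeff_succ {r : R⟦X⟧} (h : IsKernelRoot t r) (k : ℕ) :
    coeff (k + 1) r = coeff (k + 1) (X : R⟦X⟧) + (2 + t) * coeff (k + 1) (r ^ 2) +
      (1 - t ^ 2) * coeff k (r ^ 2) - coeff (k + 1) (r ^ 3) - 2 * coeff k r := by
  have h1 : r = X + C (2 + t) * r ^ 2 + X * (C (1 - t ^ 2) * r ^ 2) - r ^ 3 -
      X * (C 2 * r) := by
    have := ((isKernelRoot_iff t).1 h).2
    rw [rootStep] at this
    simp only [map_add, map_sub, map_pow, map_one, map_ofNat]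
    linear_combination -this
  -- Made opaque so that `simp` does not split `C (2 + t)` and `C (1 - t ^ 2)`.
  generalize 2 + t = a at h1 ⊢
  generalize 1 - t ^ 2 = b at h1 ⊢
  conv_lhs => rw [h1]
  simp only [map_add, map_sub, coeff_succ_X_mul, coeff_C_mul]

theorem IsKernelRoot.coeffs {r : R⟦X⟧} (h : IsKernelRoot t r) :
    coeff 1 r = 1 ∧ coeff 2 r = t ∧ coeff 3 r = t ^ 2 + 2 * t ∧
      coeff 4 r = t ^ 3 + 8 * t ^ 2 + 3 * t ∧
      coeff 5 r = t ^ 4 + 22 * t ^ 3 + 27 * t ^ 2 + 4 * t := by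
  have h0 : coeff 0 r = 0 := by simpa using h.1
  have e1 : coeff 1 r = 1 := by
    rw [h.coeff_succ t 0]
    simp [pow_succ, coeff_mul, Finset.Nat.antidiagonal_succ, h.1]
  have e2 : coeff 2 r = t := by
    rw [h.coeff_succ t 1]
    simp [pow_succ, coeff_mul, Finset.Nat.antidiagonal_succ, coeff_X, h.1, e1]
  have e3 : coeff 3 r = t ^ 2 + 2 * t := by
    rw [h.coeff_succ t 2]
    simp [pow_succ, coeff_mul, Finset.Nat.antidiagonal_succ, coeff_X, h.1, e1, e2]
    ring
  have e4 : coeff 4 r = t ^ 3 + 8 * t ^ 2 + 3 * t := by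
    rw [h.coeff_succ t 3]
    simp [pow_succ, coeff_mul, Finset.Nat.antidiagonal_succ, coeff_X, h.1, e1, e2, e3]
    ring
  refine ⟨e1, e2, e3, e4, ?_⟩
  rw [h.coeff_succ t 4]
  simp [pow_succ, coeff_mul, Finset.Nat.antidiagonal_succ, coeff_X, h.1, e1, e2, e3, e4]
  ring

theorem IsKernelRoot.map {S : Type*} [CommRing S] (φ : R →+* S) {r : R⟦X⟧}
    (h : IsKernelRoot t r) : IsKernelRoot (φ t) (PowerSeries.map φ r) := by
  refine ⟨?_, ?_⟩
  · rw [← coeff_zero_eq_constantCoeff_apply, coeff_map, coeff_zero_eq_constantCoeff_apply, h.1,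
      map_zero]
  · simpa [map_ofNat (PowerSeries.map φ) 2] using congrArg (PowerSeries.map φ) h.2

end Root

/-! ### The specialization at `s = xt`, `u = 1`, and the passage to any ring. -/

section Specialization

variable {R : Type*} [CommRing R] (t : R)

theorem coeff_GSpec (k : ℕ) :
    coeff k (GSpec t) = ∑ np ∈ Finset.HasAntidiagonal.antidiagonal k,
      if 1 ≤ np.1 ∧ 1 ≤ np.2 then t ^ np.2 * ∑ e ∈ inv021 np.1 np.2, t ^ asc e else 0 := by
  let E : ℕ × ℕ ≃ (Fin 2 →₀ ℕ) :=
    (finTwoArrowEquiv ℕ).symm.trans Finsupp.equivFunOnFinite.symm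
  have h0 : ∀ np, E np 0 = np.1 := fun np => rfl
  have h1 : ∀ np, E np 1 = np.2 := fun np => rfl
  rw [GSpec, PowerSeries.coeff, MvPowerSeries.coeff_subst (hasSubst_point t),
    ← finsum_comp_equiv E]
  have key : ∀ np : ℕ × ℕ,
      MvPowerSeries.coeff (E np) (MvPowerSeries.map (Polynomial.evalRingHom (1 : R)) (G t)) •
        MvPowerSeries.coeff (Finsupp.single () k) ((E np).prod fun s e => point t s ^ e) =
      if k = np.1 + np.2 then
        if 1 ≤ np.1 ∧ 1 ≤ np.2 then t ^ np.2 * ∑ e ∈ inv021 np.1 np.2, t ^ asc e else 0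
      else 0 := by
    intro np
    have hp : ((E np).prod fun s e => point t s ^ e) =
        C (t ^ np.2) * X ^ (np.1 + np.2) := by
      rw [Finsupp.prod_fintype _ _ fun _ => pow_zero _, Fin.prod_univ_two, h0, h1]
      simp [point, mul_pow, pow_add]
      ring
    have hc : MvPowerSeries.coeff (E np)
        (MvPowerSeries.map (Polynomial.evalRingHom (1 : R)) (G t)) =
        if 1 ≤ np.1 ∧ 1 ≤ np.2 then ∑ e ∈ inv021 np.1 np.2, t ^ asc e else 0 := by
      rw [MvPowerSeries.coeff_map]
      change Polynomial.evalRingHom 1 (G t (E np)) = _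
      rw [G, h0, h1, apply_ite (Polynomial.evalRingHom (1 : R)), map_sum, map_zero]
      simp
    rw [hp, hc]
    change _ • PowerSeries.coeff k _ = _
    rw [coeff_C_mul, coeff_X_pow]
    split_ifs <;> simp [mul_comm]
  rw [finsum_congr key, finsum_eq_sum_of_support_subset (s := Finset.HasAntidiagonal.antidiagonal k)]
  · refine Finset.sum_congr rfl fun np hnp => ?_
    rw [if_pos (Finset.HasAntidiagonal.mem_antidiagonal.1 hnp).symm]
  · intro np hnp
    rw [Function.mem_support] at hnp
    by_contra hne
    refine hnp (if_neg fun h => hne ?_)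
    simpa using h.symm

theorem map_GSpec {S : Type*} [CommRing S] (φ : R →+* S) :
    PowerSeries.map φ (GSpec t) = GSpec (φ t) := by
  ext k
  rw [coeff_map, coeff_GSpec, coeff_GSpec, map_sum]
  refine Finset.sum_congr rfl fun np _ => ?_
  split_ifs <;> simp

/-- The factor `X` arises because `total` indexes sequences of length `n + 1` by `n`; `p = 0`
contributes nothing. -/
theorem GSpec_eq_total :
    GSpec t = X * total (C t) (fullSum (C t) (1 : R⟦X⟧)) := by
  have hf : ∀ n p, fullSum (C t) (1 : R⟦X⟧) n p = C (∑ e ∈ inv021 (n + 1) p, t ^ asc e) := by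
    intro n p
    simp [fullSum, weight]
  ext k
  rw [coeff_GSpec]
  rcases k with - | k
  · simp
  · rw [coeff_succ_X_mul, Finset.Nat.sum_antidiagonal_succ, if_neg (by simp), zero_add,
      total, coeff_diag, Finset.sum_eq_single (a := (k, 0)) (f := fun ij : ℕ × ℕ => coeff ij.2 _)]
    · rw [map_sum]
      refine Finset.sum_congr rfl fun np _ => ?_
      simp only [hf, ← map_pow, ← map_mul, coeff_zero_C]
      rcases np with ⟨n, - | p⟩
      · simp [inv021_zero_right]
      · simp
    · rintro ⟨i, j⟩ hij hne
      rw [Finset.HasAntidiagonal.mem_antidiagonal] at hij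
      have hj : j ≠ 0 := by
        rintro rfl
        exact hne (by simpa using hij)
      simp only [hf, ← map_pow, ← map_mul, ← map_sum, coeff_C, if_neg hj]
    · simp

theorem GSpec_mul_of_isDomain [IsDomain R] (ht : t ≠ 0) {r : R⟦X⟧} (h : IsKernelRoot t r) :
    GSpec t * ((1 - r) * (1 - X * C t)) = C t * ((1 + X - X * C t) * r - X) := by
  obtain ⟨z, rfl⟩ := X_dvd_iff.2 h.1
  have hz : constantCoeff z = 1 := by
    simpa using (h.coeffs t).1
  have h2 := h.2
  have key := total_fullSum_one (C t) z 
    (by rwa [Ne, map_eq_zero_iff _ C_injective]) hz (by linear_combination h2)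
  have hu : 1 - z * X - C t * (z * X) ≠ 0 := by
    intro h
    have := congrArg constantCoeff h
    simp at this
  refine mul_right_cancel₀ hu ?_
  rw [GSpec_eq_total]
  -- With `r = Xz`, `key` reads `GSpec t * (1 - Xt)(1 - r - tr) = t r²`; the cubic turns this into
  -- the stated fraction.
  linear_combination X * (1 - X * z) * key - C t * h2

theorem GSpec_mul {r : R⟦X⟧} (h : IsKernelRoot t r) :
    GSpec t * ((1 - r) * (1 - X * C t)) = C t * ((1 + X - X * C t) * r - X) := by
  -- Universal case: in `ℤ[t]` the variable is nonzero, and uniqueness identifies `r` with the image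
  -- of the universal root.
  let φ : Polynomial ℤ →+* R := Polynomial.eval₂RingHom (Int.castRingHom R) t
  have hφ : φ Polynomial.X = t := by simp [φ]
  obtain ⟨r₀, h₀⟩ := exists_isKernelRoot (Polynomial.X : Polynomial ℤ)
  have hr : r = PowerSeries.map φ r₀ := h.unique t (hφ ▸ h₀.map _ φ)
  have := congrArg (PowerSeries.map φ) (GSpec_mul_of_isDomain _ Polynomial.X_ne_zero h₀)
  simpa [map_GSpec, hφ, ← hr] using this

end Specialization

end InvSeq

theorem mainTheorem4 {R : Type*} [CommRing R] (t : R) :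
    (∃! r : PowerSeries R, InvSeq.IsKernelRoot t r) ∧
    ∀ r : PowerSeries R, InvSeq.IsKernelRoot t r →
      (PowerSeries.coeff 1 r = 1 ∧
        PowerSeries.coeff 2 r = t ∧
        PowerSeries.coeff 3 r = t ^ 2 + 2 * t ∧
        PowerSeries.coeff 4 r = t ^ 3 + 8 * t ^ 2 + 3 * t ∧
        PowerSeries.coeff 5 r = t ^ 4 + 22 * t ^ 3 + 27 * t ^ 2 + 4 * t) ∧
      IsUnit ((1 - r) * (1 - PowerSeries.X * PowerSeries.C t)) ∧
      InvSeq.GSpec t =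
        PowerSeries.C t *
          ((1 + PowerSeries.X - PowerSeries.X * PowerSeries.C t) * r - PowerSeries.X) *
          Ring.inverse ((1 - r) * (1 - PowerSeries.X * PowerSeries.C t)) := by
  refine ⟨?_, fun r h => ?_⟩
  · obtain ⟨r, h⟩ := InvSeq.exists_isKernelRoot t
    exact ⟨r, h, fun r' h' => h'.unique t h⟩
  · have hu : IsUnit ((1 - r) * (1 - PowerSeries.X * PowerSeries.C t)) := by
      rw [PowerSeries.isUnit_iff_constantCoeff]
      simp [h.1]
    refine ⟨h.coeffs t, hu, ?_⟩
    rw [← InvSeq.GSpec_mul t h, Ring.mul_inverse_cancel_right _ _ hu]
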